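/- Let $M$ be a field of characteristic $\neq 3$ and fix an algebraic closure of $M$, in which all splitting fields are taken. Let $a\neq b$ be elements of $M$ such that $X^3+aX+a$ and $X^3+bX+b$ are separable over $M$, let $L_a$ and $L_b$ be their splitting fields over $M$, and put $G_a=\mathrm{Gal}(L_a/M)$, $G_b=\mathrm{Gal}(L_b/M)$. Set $$H(a,b;X)=a(X^2+9X-3a)^3-b(X^3-2aX^2-9aX-2a^2-27a)^2\in M[X],$$ and let the decomposition type of $H(a,b;X)$ be the multiset of degrees of its irreducible factors over $M$, written $(d_1)(d_2)\cdots$. 1. Suppose that $X^3+aX+a$ is irreducible over $M$. Then $G_a$ is isomorphic to $\mathfrak S_3$ or $C_3$, $G_b$ is isomorphic to one of $\mathfrak S_3$, $C_3$, $C_2$, $\{1\}$, and the following hold. - $G_a\cong\mathfrak S_3$, $G_b\cong\mathfrak S_3$: the decomposition type of $H(a,b;X)$ is one of $(6)$, $(3)(3)$, $(1)(2)(3)$. It is $(6)$ iff $L_a\neq L_b$ and $L_a\cap L_b=M$; it is $(3)(3)$ iff $L_a\ne L_b$ and $[L_a\cap L_b:M]=2$; it is $(1)(2)(3)$ iff $L_a=L_b$.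 - $G_a\cong\mathfrak S_3$, $G_b\cong C_3$: $L_a\cap L_b=M$ and the type is $(6)$. - $G_a\cong\mathfrak S_3$, $G_b\cong C_2$: the type is $(6)$ iff $L_a\not\supseteq L_b$, and it is $(3)(3)$ iff $L_a\supseteq L_b$. - $G_a\cong\mathfrak S_3$, $G_b=\{1\}$: $L_a\supseteq L_b$ and the type is $(6)$. - $G_a\cong C_3$, $G_b\cong C_3$: the type is $(3)(3)$ iff $L_a\neq L_b$, and it is $(1)(1)(1)(3)$ iff $L_a=L_b$. - $G_a\cong C_3$, $G_b\cong C_2$: $L_a\cap L_b=M$ and the type is $(6)$. - $G_a\cong C_3$, $G_b=\{1\}$: $L_a\supseteq L_b$ and the type is $(3)(3)$. 2. Whether or not $X^3+aX+a$ is irreducible, $L_a=L_b$ if and only if there exists $u\in M$ with $u^3-2au^2-9au-2a^2-27a\neq 0$ and $$b=\frac{a(u^2+9u-3a)^3}{(u^3-2au^2-9au-2a^2-27a)^2}.$$ -/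

import Mathlib

open Polynomial

noncomputable section

namespace CubicSubfield

/-- The cubic polynomial `X³ + sX + s`. -/
def cubic {M : Type*} [Field M] (s : M) : M[X] :=
  X ^ 3 + C s * X + C s

/-- The sextic polynomial
`H(a,b;X) = a(X² + 9X - 3a)³ - b(X³ - 2aX² - 9aX - 2a² - 27a)²`. -/
def H {M : Type*} [Field M] (a b : M) : M[X] :=
  C a * (X ^ 2 + 9 * X - C (3 * a)) ^ 3 -
    C b * (X ^ 3 - C (2 * a) * X ^ 2 - C (9 * a) * X - C (2 * a ^ 2 + 27 * a)) ^ 2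

/-- The splitting field over `M` of a polynomial `p`, taken inside a fixed
algebraic closure `Ω` of `M`: the field generated over `M` by the roots of `p`. -/
def Spl (M : Type*) [Field M] (Ω : Type*) [Field Ω] [Algebra M Ω] (p : M[X]) :
    IntermediateField M Ω :=
  IntermediateField.adjoin M (p.rootSet Ω)

/-- The group of `M`-automorphisms of `L` is isomorphic to the group `G`. -/
def HasGroup {M : Type*} [Field M] {Ω : Type*} [Field Ω] [Algebra M Ω]
    (L : IntermediateField M Ω) (G : Type) [Group G] : Prop :=
  Nonempty ((L ≃ₐ[M] L) ≃* G)

/-- The symmetric group of degree three. -/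
abbrev S₃ : Type := Equiv.Perm (Fin 3)

/-- The cyclic group of order `n` (for `n ≥ 1`), written multiplicatively. -/
abbrev Cyc (n : ℕ) : Type := Multiplicative (ZMod n)

/-- The decomposition type of `p` over `M`: the multiset of the degrees of its
irreducible factors, counted with multiplicity. -/
def decompType {M : Type*} [Field M] (p : M[X]) : Multiset ℕ :=
  (UniqueFactorizationMonoid.factors p).map natDegree

end CubicSubfield

end

/-!
Let `x₀, x₁, x₂` and `z₀, z₁, z₂` be the roots of `X³ + aX + a` and `X³ + bX + b`. Both triples
have sum zero, so for every bijection `xᵢ ↦ zᵢ` there is a unique pair `(u, β)` with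
`zᵢ = β (u xᵢ + 3 xᵢ² + 2a)`; here `β ≠ 0` because `a ≠ b` (`exists_param`, `param_unique`). The
elements `u xᵢ + 3 xᵢ² + 2a` are the roots of `Y³ + a P(u) Y + a Q(u)`, where
`H = a P³ - b Q²`; comparison with `X³ + bX + b` gives `H(u) = 0` and `β = P(u) / Q(u)`
(`param_eq`). Hence the roots of `H` are six distinct elements, in Galois-equivariant bijection
with the six bijections between the two sets of roots.

Let `K ≤ S₃ × S₃` be the image of the Galois group acting on both sets of roots
(`exists_jointGroup`). The degrees of the irreducible factors of `H` are the sizes of the orbits of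
`K` on `S₃` under `(σ, τ) • φ = τ φ σ⁻¹` (`decompType_eq`), and `H` has a root in `M` exactly when
`K` fixes some `φ`. The degrees of the two splitting fields and of their compositum are the
orders of the two projections of `K` and of `K` itself; the degree of the intersection follows
from `finrank_inf_mul_finrank_sup`.

It remains to find the orbits from these orders. Let `A` and `B` be the orders of `K ∩ (S₃ × 1)`
and `K ∩ (1 × S₃)`. If `3 ∣ A`, then `K` contains `A₃ × 1`, whose orbits are the two parity classes,
and `K` joins them exactly when `A` or `B` is even (`orbitType_six`, `orbitType_three_three`). If
`A = B = 1`, that is, if the splitting fields coincide, then `K` is the graph of a conjugation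
(`exists_fixed`), and the
orbits are those of a conjugation action on `S₃` (`orbitType_of_card_eq_six`,
`orbitType_of_card_eq_three`). The case `A = 2` does not occur when the first projection is `S₃`.
-/

namespace CubicSubfield

open Equiv

/-! ### Subgroups of `S₃ × S₃` and their orbits on bijections -/

/-- `d` lists the sizes of the orbits of `K ≤ S₃ × S₃` acting on `S₃` by
`(σ, τ) • φ = τ φ σ⁻¹`. The orbits are given as a multiset of finsets that add up to `S₃`. -/
def OrbitType (K : Subgroup (S₃ × S₃)) (d : Multiset ℕ) : Prop :=
  ∃ parts : Multiset (Finset S₃),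
    (parts.map Finset.val).sum = Finset.univ.val ∧
    (∀ O ∈ parts, ∃ i, ∀ j, j ∈ O ↔ ∃ k ∈ K, k.2 * i * k.1⁻¹ = j) ∧
    d = parts.map Finset.card

/-- The elements `σ` with `(σ, 1) ∈ K`. -/
def leftKer (K : Subgroup (S₃ × S₃)) : Subgroup S₃ := K.comap (MonoidHom.inl S₃ S₃)

/-- The elements `τ` with `(1, τ) ∈ K`. -/
def rightKer (K : Subgroup (S₃ × S₃)) : Subgroup S₃ := K.comap (MonoidHom.inr S₃ S₃)

lemma mem_leftKer {K : Subgroup (S₃ × S₃)} {σ : S₃} : σ ∈ leftKer K ↔ (σ, 1) ∈ K := Iff.rfl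

lemma mem_rightKer {K : Subgroup (S₃ × S₃)} {τ : S₃} : τ ∈ rightKer K ↔ (1, τ) ∈ K := Iff.rfl

lemma card_leftKer_mul (K : Subgroup (S₃ × S₃)) :
    Nat.card (leftKer K) * Nat.card (K.map (MonoidHom.snd S₃ S₃)) = Nat.card K := by
  set f := (MonoidHom.snd S₃ S₃).comp K.subtype
  have h1 : f.range = K.map (MonoidHom.snd S₃ S₃) := by
    rw [MonoidHom.range_comp, Subgroup.range_subtype]
  have e : leftKer K ≃ f.ker :=
    { toFun := fun σ => ⟨⟨(σ.1, 1), σ.2⟩, rfl⟩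
      invFun := fun k => ⟨k.1.1.1, by
        have h := k.1.2
        have h2 : k.1.1.2 = 1 := k.2
        rw [mem_leftKer, ← h2]; exact h⟩
      left_inv := fun σ => rfl
      right_inv := fun k => by
        have h2 : k.1.1.2 = 1 := k.2
        apply Subtype.ext; apply Subtype.ext; exact Prod.ext rfl h2.symm }
  rw [Nat.card_congr e, ← h1, ← Nat.card_congr (QuotientGroup.quotientKerEquivRange f).toEquiv,
    mul_comm, ← Subgroup.card_eq_card_quotient_mul_card_subgroup]

lemma card_rightKer_mul (K : Subgroup (S₃ × S₃)) :
    Nat.card (rightKer K) * Nat.card (K.map (MonoidHom.fst S₃ S₃)) = Nat.card K := by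
  set f := (MonoidHom.fst S₃ S₃).comp K.subtype
  have h1 : f.range = K.map (MonoidHom.fst S₃ S₃) := by
    rw [MonoidHom.range_comp, Subgroup.range_subtype]
  have e : rightKer K ≃ f.ker :=
    { toFun := fun σ => ⟨⟨(1, σ.1), σ.2⟩, rfl⟩
      invFun := fun k => ⟨k.1.1.2, by
        have h := k.1.2
        have h2 : k.1.1.1 = 1 := k.2
        rw [mem_rightKer, ← h2]; exact h⟩
      left_inv := fun σ => rfl
      right_inv := fun k => by
        have h2 : k.1.1.1 = 1 := k.2
        apply Subtype.ext; apply Subtype.ext; exact Prod.ext h2.symm rfl }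
  rw [Nat.card_congr e, ← h1, ← Nat.card_congr (QuotientGroup.quotientKerEquivRange f).toEquiv,
    mul_comm, ← Subgroup.card_eq_card_quotient_mul_card_subgroup]

lemma even_mem_of_three_dvd_card (A : Subgroup S₃) (h : 3 ∣ Nat.card A) {τ : S₃}
    (hτ : Perm.sign τ = 1) : τ ∈ A := by
  obtain ⟨σ, hσ⟩ := exists_prime_orderOf_dvd_card' 3 h
  have h1 : (σ : S₃) ^ 3 = 1 := by
    have := pow_orderOf_eq_one σ
    rw [hσ] at this
    exact_mod_cast congrArg Subtype.val this
  have h2 : (σ : S₃) ≠ 1 := by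
    rintro h
    have : σ = 1 := Subtype.ext h
    rw [this, orderOf_one] at hσ
    omega
  have key : ∀ σ τ : S₃, σ ^ 3 = 1 → σ ≠ 1 → Perm.sign τ = 1 → τ = 1 ∨ τ = σ ∨ τ = σ ^ 2 := by
    decide
  rcases key σ τ h1 h2 hτ with h | h | h <;> rw [h]
  · exact A.one_mem
  · exact σ.2
  · exact A.pow_mem σ.2 2

lemma two_dvd_card_iff (A : Subgroup S₃) :
    2 ∣ Nat.card A ↔ ∃ σ ∈ A, Perm.sign σ = -1 := by
  constructor
  · intro h
    obtain ⟨σ, hσ⟩ := exists_prime_orderOf_dvd_card' 2 h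
    have h1 : (σ : S₃) ^ 2 = 1 := by
      have := pow_orderOf_eq_one σ
      rw [hσ] at this
      exact_mod_cast congrArg Subtype.val this
    have h2 : (σ : S₃) ≠ 1 := by
      rintro h
      have : σ = 1 := Subtype.ext h
      rw [this, orderOf_one] at hσ
      omega
    have key : ∀ σ : S₃, σ ^ 2 = 1 → σ ≠ 1 → Perm.sign σ = -1 := by decide
    exact ⟨σ, σ.2, key σ h1 h2⟩
  · rintro ⟨σ, hσ, hs⟩
    have key : ∀ σ : S₃, Perm.sign σ = -1 → σ ^ 2 = 1 ∧ σ ≠ 1 := by decide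
    obtain ⟨h1, h2⟩ := key σ hs
    have : orderOf (⟨σ, hσ⟩ : A) = 2 := by
      apply orderOf_eq_prime
      · exact Subtype.ext h1
      · exact fun h => h2 (congrArg Subtype.val h)
    rw [← this]
    exact orderOf_dvd_natCard _

/-- Cubing kills an even permutation of three letters and fixes an odd one; so an element of `K`
whose two components have different signs already shows an odd element in one of the kernels. -/
lemma exists_sign_ne_iff (K : Subgroup (S₃ × S₃)) :
    (∃ k ∈ K, Perm.sign k.1 ≠ Perm.sign k.2) ↔
      2 ∣ Nat.card (leftKer K) ∨ 2 ∣ Nat.card (rightKer K) := by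
  rw [two_dvd_card_iff, two_dvd_card_iff]
  have key : ∀ σ : S₃, (Perm.sign σ = 1 ∧ σ ^ 3 = 1) ∨ (Perm.sign σ = -1 ∧ σ ^ 3 = σ) := by decide
  constructor
  · rintro ⟨⟨σ, τ⟩, hk, hs⟩
    have h3 := K.pow_mem hk 3
    rw [Prod.pow_mk] at h3
    rcases key σ with ⟨h1, h1'⟩ | ⟨h1, h1'⟩ <;> rcases key τ with ⟨h2, h2'⟩ | ⟨h2, h2'⟩ <;>
      rw [h1', h2'] at h3
    · exact absurd (h1.trans h2.symm) hs
    · exact Or.inr ⟨τ, h3, h2⟩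
    · exact Or.inl ⟨σ, h3, h1⟩
    · exact absurd (h1.trans h2.symm) hs
  · rintro (⟨σ, hσ, hs⟩ | ⟨σ, hσ, hs⟩)
    · exact ⟨(σ, 1), hσ, by simp [hs]⟩
    · exact ⟨(1, σ), hσ, by simp [hs]⟩

lemma sign_eq_one_or (σ : S₃) : Perm.sign σ = 1 ∨ Perm.sign σ = -1 := by
  revert σ; decide

/-- If `A₃ × 1 ≤ K`, each orbit is a union of parity classes; an element of mixed sign joins the
two classes. -/
lemma orbitType_six (K : Subgroup (S₃ × S₃)) (h3 : 3 ∣ Nat.card (leftKer K))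
    (h2 : 2 ∣ Nat.card (leftKer K) ∨ 2 ∣ Nat.card (rightKer K)) : OrbitType K {6} := by
  obtain ⟨⟨σ, τ⟩, hk, hs⟩ := (exists_sign_ne_iff K).2 h2
  refine ⟨{Finset.univ}, by simp, ?_, by decide⟩
  intro O hO
  rw [Multiset.mem_singleton] at hO
  subst hO
  refine ⟨1, fun j => ⟨fun _ => ?_, fun _ => Finset.mem_univ _⟩⟩
  rcases sign_eq_one_or j with h | h
  · refine ⟨(j⁻¹, 1), even_mem_of_three_dvd_card _ h3 (by simp [h]), by simp⟩
  · have h4 : Perm.sign (j⁻¹ * τ * σ⁻¹) = 1 := by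
      simp only [Perm.sign_mul, Perm.sign_inv, h]
      rcases sign_eq_one_or σ with h1 | h1 <;> rcases sign_eq_one_or τ with h2 | h2 <;>
        simp_all
    have h5 := K.mul_mem (mem_leftKer.1 (even_mem_of_three_dvd_card _ h3 h4)) hk
    refine ⟨_, h5, ?_⟩
    simp

/-- If `A₃ × 1 ≤ K` and no element has mixed sign, the orbits are the two parity classes. -/
lemma orbitType_three_three (K : Subgroup (S₃ × S₃)) (h3 : 3 ∣ Nat.card (leftKer K))
    (hl : ¬ 2 ∣ Nat.card (leftKer K)) (hr : ¬ 2 ∣ Nat.card (rightKer K)) :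
    OrbitType K {3, 3} := by
  have hs : ∀ k ∈ K, Perm.sign k.1 = Perm.sign k.2 := by
    by_contra! h
    rcases (exists_sign_ne_iff K).1 h with h | h
    exacts [hl h, hr h]
  refine ⟨{Finset.univ.filter fun φ => Perm.sign φ = 1,
    Finset.univ.filter fun φ => Perm.sign φ = -1}, by decide, ?_, by decide⟩
  have main : ∀ i j : S₃, Perm.sign j = Perm.sign i ↔ ∃ k ∈ K, k.2 * i * k.1⁻¹ = j := by
    intro i j
    constructor
    · intro h
      refine ⟨(j⁻¹ * i, 1), even_mem_of_three_dvd_card _ h3 (by simp [h]), by simp⟩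
    · rintro ⟨k, hk, rfl⟩
      simp only [Perm.sign_mul, Perm.sign_inv, hs k hk]
      rcases sign_eq_one_or k.2 with h | h <;> simp [h]
  intro O hO
  rw [Multiset.insert_eq_cons, Multiset.mem_cons, Multiset.mem_singleton] at hO
  rcases hO with rfl | rfl
  · refine ⟨1, fun j => ?_⟩
    rw [← main]; simp
  · refine ⟨swap 0 1, fun j => ?_⟩
    rw [← main]; simp

/-- The left kernel is normalized by the first projection of `K`, and a subgroup of `S₃` of order
two is not normal. -/
lemma card_leftKer_ne_two (K : Subgroup (S₃ × S₃))
    (h6 : Nat.card (K.map (MonoidHom.fst S₃ S₃)) = 6) : Nat.card (leftKer K) ≠ 2 := by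
  intro h2
  obtain ⟨σ, hσ, hs⟩ := (two_dvd_card_iff _).1 (dvd_of_eq h2.symm)
  have htop : K.map (MonoidHom.fst S₃ S₃) = ⊤ := by
    apply Subgroup.eq_top_of_card_eq
    rw [h6]; simp [Fintype.card_perm, Nat.factorial]
  have hconj : ∀ g, g * σ * g⁻¹ ∈ leftKer K := by
    intro g
    have hg : g ∈ K.map (MonoidHom.fst S₃ S₃) := by rw [htop]; trivial
    obtain ⟨⟨g', t⟩, hk, rfl⟩ := hg
    have := K.mul_mem (K.mul_mem hk hσ) (K.inv_mem hk)
    simpa [mem_leftKer] using this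
  have key : ∀ σ : S₃, Perm.sign σ = -1 → ∃ g h : S₃, σ ≠ g * σ * g⁻¹ ∧ σ ≠ h * σ * h⁻¹ ∧
      g * σ * g⁻¹ ≠ h * σ * h⁻¹ := by decide
  obtain ⟨g, h, h1, h3, h4⟩ := key σ hs
  have := Fintype.ofFinite (leftKer K)
  have : ({⟨σ, hσ⟩, ⟨_, hconj g⟩, ⟨_, hconj h⟩} : Finset (leftKer K)).card = 3 := by
    rw [Finset.card_eq_three]
    exact ⟨_, _, _, by simpa using h1, by simpa using h3, by simpa using h4, rfl⟩
  have h5 := Finset.card_le_univ ({⟨σ, hσ⟩, ⟨_, hconj g⟩, ⟨_, hconj h⟩} : Finset (leftKer K))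
  rw [this, ← Nat.card_eq_fintype_card, h2] at h5
  omega

lemma eq_one_of_card_eq_one {A : Subgroup S₃} (h : Nat.card A = 1) {σ : S₃} (hσ : σ ∈ A) :
    σ = 1 := by
  rw [Subgroup.card_eq_one] at h
  rwa [h, Subgroup.mem_bot] at hσ

/-- A subgroup of `S₃` is cyclic or the whole group. -/
lemma cyclic_or_eq_top (A : Subgroup S₃) :
    (∃ σ ∈ A, ∀ l ∈ A, ∃ n : Fin 3, l = σ ^ (n : ℕ)) ∨ A = ⊤ := by
  have h1 : ∀ σ τ : S₃, Perm.sign σ = 1 → σ ≠ 1 → Perm.sign τ = 1 →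
      ∃ n : Fin 3, τ = σ ^ (n : ℕ) := by decide
  have h2 : ∀ σ τ g : S₃, Perm.sign σ = 1 → σ ≠ 1 → Perm.sign τ = -1 →
      ∃ i j : Fin 3, g = σ ^ (i : ℕ) * τ ^ (j : ℕ) := by decide
  by_cases he : ∃ σ ∈ A, Perm.sign σ = 1 ∧ σ ≠ 1
  · obtain ⟨σ, hσ, hs, hσ1⟩ := he
    by_cases ho : ∃ τ ∈ A, Perm.sign τ = -1
    · obtain ⟨τ, hτ, ht⟩ := ho
      right
      rw [eq_top_iff]
      intro g _
      obtain ⟨i, j, rfl⟩ := h2 σ τ g hs hσ1 ht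
      exact A.mul_mem (A.pow_mem hσ _) (A.pow_mem hτ _)
    · left
      push Not at ho
      exact ⟨σ, hσ, fun l hl => h1 σ l hs hσ1 ((sign_eq_one_or l).resolve_right (ho l hl))⟩
  · left
    push Not at he
    by_cases ho : ∃ τ ∈ A, Perm.sign τ = -1
    · obtain ⟨τ, hτ, ht⟩ := ho
      refine ⟨τ, hτ, fun l hl => ?_⟩
      rcases sign_eq_one_or l with h | h
      · exact ⟨0, by simp [he l hl h]⟩
      · have := he _ (A.mul_mem hl (A.inv_mem hτ)) (by simp [h, ht])
        exact ⟨1, by simpa using mul_inv_eq_one.1 this⟩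
    · push Not at ho
      exact ⟨1, A.one_mem, fun l hl =>
        ⟨0, by simp [he l hl ((sign_eq_one_or l).resolve_right (ho l hl))]⟩⟩

/-- Two faithful actions of one group on three letters are isomorphic. -/
lemma exists_fixed (K : Subgroup (S₃ × S₃)) (hl : Nat.card (leftKer K) = 1)
    (hr : Nat.card (rightKer K) = 1) : ∃ φ : S₃, ∀ k ∈ K, k.2 = φ * k.1 * φ⁻¹ := by
  have hl' : ∀ σ, (σ, 1) ∈ K → σ = 1 := fun σ h => eq_one_of_card_eq_one hl h
  have hr' : ∀ σ, (1, σ) ∈ K → σ = 1 := fun σ h => eq_one_of_card_eq_one hr h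
  have ext' : ∀ σ τ τ', (σ, τ) ∈ K → (σ, τ') ∈ K → τ = τ' := by
    intro σ τ τ' h h'
    have := K.mul_mem h (K.inv_mem h')
    simp only [Prod.inv_mk, Prod.mk_mul_mk, mul_inv_cancel] at this
    exact mul_inv_eq_one.1 (hr' _ this)
  have hpow : ∀ σ τ, (σ, τ) ∈ K → ∀ n : ℕ, σ ^ n = 1 ↔ τ ^ n = 1 := by
    intro σ τ h n
    have := K.pow_mem h n
    rw [Prod.pow_mk] at this
    constructor
    · intro h1; rw [h1] at this; exact hr' _ this
    · intro h1; rw [h1] at this; exact hl' _ this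
  rcases cyclic_or_eq_top (K.map (MonoidHom.fst S₃ S₃)) with hcyc | htop
  · obtain ⟨_, ⟨⟨σ, τ⟩, hk, rfl⟩, hgen⟩ := hcyc
    have key : ∀ σ τ : S₃, (σ ^ 1 = 1 ↔ τ ^ 1 = 1) → (σ ^ 2 = 1 ↔ τ ^ 2 = 1) →
        ∃ φ : S₃, τ = φ * σ * φ⁻¹ := by decide
    obtain ⟨φ, hφ⟩ := key σ τ (hpow _ _ hk 1) (hpow _ _ hk 2)
    refine ⟨φ, ?_⟩
    rintro ⟨σ', τ'⟩ hl
    obtain ⟨n, hn⟩ := hgen _ ⟨_, hl, rfl⟩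
    simp only [MonoidHom.coe_fst] at hn
    subst hn
    have h1 := K.pow_mem hk n
    rw [Prod.pow_mk] at h1
    rw [ext' _ _ _ hl h1, hφ, conj_pow]
  · have hsurj : ∀ σ, ∃ τ, (σ, τ) ∈ K := by
      intro σ
      have : σ ∈ K.map (MonoidHom.fst S₃ S₃) := by rw [htop]; trivial
      obtain ⟨⟨_, τ⟩, hk, rfl⟩ := this
      exact ⟨τ, hk⟩
    obtain ⟨t, ht⟩ := hsurj (swap 0 1)
    obtain ⟨d, hd⟩ := hsurj (finRotate 3)
    -- A transposition and a 3-cycle of `S₃` can be conjugated simultaneously into any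
    -- other such pair.
    have key : ∀ t d : S₃, t ^ 2 = 1 ∧ ¬ t ^ 1 = 1 → d ^ 3 = 1 ∧ ¬ d ^ 1 = 1 →
        ∃ φ : S₃, t = φ * swap 0 1 * φ⁻¹ ∧ d = φ * finRotate 3 * φ⁻¹ := by decide
    obtain ⟨φ, hφt, hφd⟩ := key t d
      ⟨(hpow _ _ ht 2).1 (by decide), fun h => absurd ((hpow _ _ ht 1).2 h) (by decide)⟩
      ⟨(hpow _ _ hd 3).1 (by decide), fun h => absurd ((hpow _ _ hd 1).2 h) (by decide)⟩
    refine ⟨φ, ?_⟩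
    rintro ⟨σ, τ⟩ hk
    have gen : ∀ σ : S₃, ∃ i j : Fin 3, σ = swap 0 1 ^ (i : ℕ) * finRotate 3 ^ (j : ℕ) := by decide
    obtain ⟨i, j, rfl⟩ := gen σ
    have h1 := K.mul_mem (K.pow_mem ht i) (K.pow_mem hd j)
    rw [Prod.pow_mk, Prod.pow_mk, Prod.mk_mul_mk] at h1
    rw [ext' _ _ _ hk h1, hφt, hφd, conj_pow, conj_pow]
    simp only; group

set_option maxRecDepth 20000 in
/-- When `K` is the graph of conjugation by `φ` on `S₃`, the orbits correspond, after
translation by `φ`, to the conjugacy classes of `S₃`. -/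
lemma orbitType_one_two_three (K : Subgroup (S₃ × S₃)) (φ : S₃)
    (hφ : ∀ k ∈ K, k.2 = φ * k.1 * φ⁻¹) (h6 : ∀ σ, ∃ k ∈ K, k.1 = σ) :
    OrbitType K {1, 2, 3} := by
  have main : ∀ i j, (∃ k ∈ K, k.2 * i * k.1⁻¹ = j) ↔ ∃ σ : S₃, φ * σ * φ⁻¹ * i * σ⁻¹ = j := by
    intro i j
    constructor
    · rintro ⟨k, hk, rfl⟩; exact ⟨k.1, by rw [hφ k hk]⟩
    · rintro ⟨σ, rfl⟩
      obtain ⟨k, hk, rfl⟩ := h6 σ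
      exact ⟨k, hk, by rw [hφ k hk]⟩
  let O : S₃ → S₃ → Finset S₃ :=
    fun φ i => Finset.univ.image fun σ => φ * σ * φ⁻¹ * i * σ⁻¹
  refine ⟨{O φ φ, O φ (φ * finRotate 3), O φ (φ * swap 0 1)}, ?_, ?_, ?_⟩
  · clear main hφ; revert φ; decide
  · intro P hP
    have : ∃ i, P = O φ i := by simp at hP; rcases hP with h | h | h <;> exact ⟨_, h⟩
    obtain ⟨i, rfl⟩ := this
    exact ⟨i, fun j => by rw [main]; simp [O]⟩
  · clear main hφ; revert φ; decide

set_option maxRecDepth 20000 in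
/-- When `K` is the graph of conjugation by `φ` on `A₃`, the orbits correspond, after
translation by `φ`, to the orbits of `A₃` acting on `S₃` by conjugation. -/
lemma orbitType_one_one_one_three (K : Subgroup (S₃ × S₃)) (φ : S₃)
    (hφ : ∀ k ∈ K, k.2 = φ * k.1 * φ⁻¹) (h3 : ∀ σ, (∃ k ∈ K, k.1 = σ) ↔ Perm.sign σ = 1) :
    OrbitType K {1, 1, 1, 3} := by
  have main : ∀ i j, (∃ k ∈ K, k.2 * i * k.1⁻¹ = j) ↔
      ∃ σ : S₃, Perm.sign σ = 1 ∧ φ * σ * φ⁻¹ * i * σ⁻¹ = j := by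
    intro i j
    constructor
    · rintro ⟨k, hk, rfl⟩; exact ⟨k.1, (h3 _).1 ⟨k, hk, rfl⟩, by rw [hφ k hk]⟩
    · rintro ⟨σ, hσ, rfl⟩
      obtain ⟨k, hk, rfl⟩ := (h3 σ).2 hσ
      exact ⟨k, hk, by rw [hφ k hk]⟩
  let O : S₃ → S₃ → Finset S₃ := fun φ i =>
    (Finset.univ.filter fun σ => Perm.sign σ = 1).image fun σ => φ * σ * φ⁻¹ * i * σ⁻¹
  refine ⟨{O φ φ, O φ (φ * finRotate 3), O φ (φ * (finRotate 3)⁻¹), O φ (φ * swap 0 1)},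
    ?_, ?_, ?_⟩
  · clear main hφ; revert φ; decide
  · intro P hP
    have : ∃ i, P = O φ i := by simp at hP; rcases hP with h | h | h | h <;> exact ⟨_, h⟩
    obtain ⟨i, rfl⟩ := this
    exact ⟨i, fun j => by rw [main]; simp [O]⟩
  · clear main hφ; revert φ; decide

lemma orbitType_of_card_eq_six (K : Subgroup (S₃ × S₃)) (hl : Nat.card (leftKer K) = 1)
    (hr : Nat.card (rightKer K) = 1) (h6 : Nat.card (K.map (MonoidHom.fst S₃ S₃)) = 6) :
    OrbitType K {1, 2, 3} := by
  obtain ⟨φ, hφ⟩ := exists_fixed K hl hr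
  have htop : K.map (MonoidHom.fst S₃ S₃) = ⊤ := by
    apply Subgroup.eq_top_of_card_eq
    rw [h6]; simp [Fintype.card_perm, Nat.factorial]
  refine orbitType_one_two_three K φ hφ fun σ => ?_
  have : σ ∈ K.map (MonoidHom.fst S₃ S₃) := by rw [htop]; trivial
  exact this

lemma orbitType_of_card_eq_three (K : Subgroup (S₃ × S₃)) (hl : Nat.card (leftKer K) = 1)
    (hr : Nat.card (rightKer K) = 1) (h3 : Nat.card (K.map (MonoidHom.fst S₃ S₃)) = 3) :
    OrbitType K {1, 1, 1, 3} := by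
  obtain ⟨φ, hφ⟩ := exists_fixed K hl hr
  refine orbitType_one_one_one_three K φ hφ fun σ => ⟨?_, ?_⟩
  · intro h
    refine (sign_eq_one_or σ).resolve_right fun hs => ?_
    have := (two_dvd_card_iff (K.map (MonoidHom.fst S₃ S₃))).2 ⟨σ, h, hs⟩
    omega
  · exact even_mem_of_three_dvd_card (K.map (MonoidHom.fst S₃ S₃)) (dvd_of_eq h3.symm)

/-! ### Bijections between the roots of two cubics -/

lemma vieta {F : Type*} [Field F] {s : F} {x : Fin 3 → F} (hinj : Function.Injective x)
    (hx : ∀ i, x i ^ 3 + s * x i + s = 0) :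
    x 0 + x 1 + x 2 = 0 ∧ x 0 * x 1 + x 0 * x 2 + x 1 * x 2 = s ∧ x 0 * x 1 * x 2 = -s := by
  have h01 : x 0 - x 1 ≠ 0 := sub_ne_zero.2 fun h => absurd (hinj h) (by decide)
  have h02 : x 0 - x 2 ≠ 0 := sub_ne_zero.2 fun h => absurd (hinj h) (by decide)
  have h12 : x 1 - x 2 ≠ 0 := sub_ne_zero.2 fun h => absurd (hinj h) (by decide)
  have e1 : x 0 ^ 2 + x 0 * x 1 + x 1 ^ 2 + s = 0 :=
    mul_left_cancel₀ h01 (by linear_combination hx 0 - hx 1)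
  have e2 : x 0 ^ 2 + x 0 * x 2 + x 2 ^ 2 + s = 0 :=
    mul_left_cancel₀ h02 (by linear_combination hx 0 - hx 2)
  have e3 : x 0 + x 1 + x 2 = 0 := mul_left_cancel₀ h12 (by linear_combination e1 - e2)
  have e4 : x 0 * x 1 + x 0 * x 2 + x 1 * x 2 = s := by
    linear_combination (x 0 + x 1) * e3 - e1
  refine ⟨e3, e4, ?_⟩
  linear_combination hx 0 + x 0 * e4 - x 0 ^ 2 * e3

section Parametrization

variable {F : Type*} [Field F] {a b : F} {x z : Fin 3 → F}

/-- The vectors `(xᵢ)` and `(3xᵢ² + 2a)` are linearly independent. -/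
lemma det_ne_zero (hinj : Function.Injective x) (h1 : x 0 + x 1 + x 2 = 0)
    (h2 : x 0 * x 1 + x 0 * x 2 + x 1 * x 2 = a) :
    x 0 * (3 * x 1 ^ 2 + 2 * a) - x 1 * (3 * x 0 ^ 2 + 2 * a) ≠ 0 := by
  have h01 : x 0 - x 1 ≠ 0 := sub_ne_zero.2 fun h => absurd (hinj h) (by decide)
  have h02 : x 0 - x 2 ≠ 0 := sub_ne_zero.2 fun h => absurd (hinj h) (by decide)
  have h12 : x 1 - x 2 ≠ 0 := sub_ne_zero.2 fun h => absurd (hinj h) (by decide)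
  have h : x 2 = -(x 0 + x 1) := by linear_combination h1
  have : x 0 * (3 * x 1 ^ 2 + 2 * a) - x 1 * (3 * x 0 ^ 2 + 2 * a) =
      -(x 0 - x 1) * (x 0 - x 2) * (x 1 - x 2) := by
    rw [← h2, h]; ring
  rw [this]
  exact mul_ne_zero (mul_ne_zero (neg_ne_zero.2 h01) h02) h12

lemma exists_coeff (hinj : Function.Injective x) (h1 : x 0 + x 1 + x 2 = 0)
    (h2 : x 0 * x 1 + x 0 * x 2 + x 1 * x 2 = a) (hz : z 0 + z 1 + z 2 = 0) :
    ∃ α β : F, ∀ i, z i = α * x i + β * (3 * x i ^ 2 + 2 * a) := by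
  have hd := det_ne_zero hinj h1 h2
  set d := x 0 * (3 * x 1 ^ 2 + 2 * a) - x 1 * (3 * x 0 ^ 2 + 2 * a) with hdef
  obtain ⟨α, hα⟩ : ∃ α, α * d = z 0 * (3 * x 1 ^ 2 + 2 * a) - z 1 * (3 * x 0 ^ 2 + 2 * a) :=
    ⟨_ / d, div_mul_cancel₀ _ hd⟩
  obtain ⟨β, hβ⟩ : ∃ β, β * d = x 0 * z 1 - x 1 * z 0 := ⟨_ / d, div_mul_cancel₀ _ hd⟩
  have e0 : z 0 = α * x 0 + β * (3 * x 0 ^ 2 + 2 * a) := by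
    apply mul_right_cancel₀ hd
    rw [add_mul, mul_right_comm, hα, mul_right_comm β, hβ, hdef]; ring
  have e1 : z 1 = α * x 1 + β * (3 * x 1 ^ 2 + 2 * a) := by
    apply mul_right_cancel₀ hd
    rw [add_mul, mul_right_comm, hα, mul_right_comm β, hβ, hdef]; ring
  have e2 : z 2 = α * x 2 + β * (3 * x 2 ^ 2 + 2 * a) := by
    have h : x 2 = -(x 0 + x 1) := by linear_combination h1
    have hz2 : z 2 = -(z 0 + z 1) := by linear_combination hz
    rw [hz2, e0, e1, ← h2, h]; ring
  refine ⟨α, β, fun i => ?_⟩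
  fin_cases i
  exacts [e0, e1, e2]

/-- The elements `u xᵢ + 3 xᵢ² + 2a` are the roots of `Y³ + a P(u) Y + a Q(u)`, where `P` and `Q`
are the quadratic and the cubic polynomial occurring in `H`. Comparing with `b`, the sum of the
products in pairs and minus the product of the `zᵢ`, gives both equations. -/
lemma param_eq (h1 : x 0 + x 1 + x 2 = 0)
    (h2 : x 0 * x 1 + x 0 * x 2 + x 1 * x 2 = a) (h3 : x 0 * x 1 * x 2 = -a)
    (hz2 : z 0 * z 1 + z 0 * z 2 + z 1 * z 2 = b) (hz3 : z 0 * z 1 * z 2 = -b) {u β : F}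
    (h : ∀ i, z i = β * (u * x i + 3 * x i ^ 2 + 2 * a)) :
    b = β ^ 2 * (a * (u ^ 2 + 9 * u - 3 * a)) ∧
    b = β ^ 3 * (a * (u ^ 3 - 2 * a * u ^ 2 - 9 * a * u - 2 * a ^ 2 - 27 * a)) := by
  have hx2 : x 2 = -(x 0 + x 1) := by linear_combination h1
  rw [hx2] at h2 h3
  constructor
  · rw [← hz2, h 0, h 1, h 2, hx2]
    linear_combination β ^ 2 * (u ^ 2 + 9 * (x 0 * x 1 + x 0 * -(x 0 + x 1) + x 1 * -(x 0 + x 1))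
      - 15 * a) * h2 - 9 * β ^ 2 * u * h3
  · have : b = -(z 0 * z 1 * z 2) := by rw [hz3, neg_neg]
    rw [this, h 0, h 1, h 2, hx2]
    linear_combination β ^ 3 * (-2 * u ^ 2 * a - 9 * u * (x 0 * x 1 * -(x 0 + x 1))
      - 6 * a * (3 * (x 0 * x 1 + x 0 * -(x 0 + x 1) + x 1 * -(x 0 + x 1)) - a)) * h2
      + β ^ 3 * (-u ^ 3 + 9 * u * a - 27 * (x 0 * x 1 * -(x 0 + x 1) - a)) * h3

/-- Two different cubics of the family have no proportional triples of roots, so the quadratic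
term of the transformation cannot vanish. -/
lemma coeff_ne_zero (hab : a ≠ b) (hb : b ≠ 0)
    (hx2 : x 0 * x 1 + x 0 * x 2 + x 1 * x 2 = a) (hx3 : x 0 * x 1 * x 2 = -a)
    (hz2 : z 0 * z 1 + z 0 * z 2 + z 1 * z 2 = b) (hz3 : z 0 * z 1 * z 2 = -b) {α β : F}
    (h : ∀ i, z i = α * x i + β * (3 * x i ^ 2 + 2 * a)) : β ≠ 0 := by
  rintro rfl
  simp only [zero_mul, add_zero] at h
  have e2 : b = α ^ 2 * a := by rw [← hz2, ← hx2, h 0, h 1, h 2]; ring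
  have e3 : b = α ^ 3 * a := by
    have h1 : a = -(x 0 * x 1 * x 2) := by rw [hx3, neg_neg]
    have h2 : b = -(z 0 * z 1 * z 2) := by rw [hz3, neg_neg]
    rw [h1, h2, h 0, h 1, h 2]; ring
  have h1 : (α - 1) * b = 0 := by linear_combination α * e2 - e3
  rcases mul_eq_zero.1 h1 with h1 | h1
  · rw [sub_eq_zero.1 h1] at e2
    exact hab (by simpa using e2.symm)
  · exact hb h1

/-- Every bijection `xᵢ ↦ zᵢ` between the roots of the two cubics is a scaled Tschirnhausen
transformation with some parameter `u`. -/
lemma exists_param (hinj : Function.Injective x) (hzinj : Function.Injective z)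
    (hx : ∀ i, x i ^ 3 + a * x i + a = 0) (hz : ∀ i, z i ^ 3 + b * z i + b = 0)
    (hab : a ≠ b) (hb : b ≠ 0) :
    ∃ u β : F, ∀ i, z i = β * (u * x i + 3 * x i ^ 2 + 2 * a) := by
  obtain ⟨h1, h2, h3⟩ := vieta hinj hx
  obtain ⟨h1', h2', h3'⟩ := vieta hzinj hz
  obtain ⟨α, β, h⟩ := exists_coeff hinj h1 h2 h1'
  have hβ := coeff_ne_zero hab hb h2 h3 h2' h3' h
  exact ⟨α / β, β, fun i => by rw [h]; field_simp; ring⟩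

/-- The parameter of a bijection between the roots is determined by the bijection. -/
lemma param_unique (hinj : Function.Injective x) (hx : ∀ i, x i ^ 3 + a * x i + a = 0)
    {u β u' β' : F} (hβ : β ≠ 0) (h : ∀ i, z i = β * (u * x i + 3 * x i ^ 2 + 2 * a))
    (h' : ∀ i, z i = β' * (u' * x i + 3 * x i ^ 2 + 2 * a)) : u = u' := by
  obtain ⟨h1, h2, -⟩ := vieta hinj hx
  have hd := det_ne_zero hinj h1 h2
  have e : ∀ i, β * (u * x i + 3 * x i ^ 2 + 2 * a) = β' * (u' * x i + 3 * x i ^ 2 + 2 * a) :=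
    fun i => (h i).symm.trans (h' i)
  have hββ : β = β' := by
    rw [← sub_eq_zero]
    exact (mul_eq_zero.1 (by linear_combination x 0 * e 1 - x 1 * e 0 :
      (β - β') * (x 0 * (3 * x 1 ^ 2 + 2 * a) - x 1 * (3 * x 0 ^ 2 + 2 * a)) = 0)).resolve_right hd
  subst hββ
  have e' : ∀ i, (u - u') * x i = 0 := fun i => mul_left_cancel₀ hβ (by linear_combination e i)
  rw [← sub_eq_zero]
  by_contra hne
  have hz : ∀ i, x i = 0 := fun i => (mul_eq_zero.1 (e' i)).resolve_left hne
  exact absurd (hinj ((hz 0).trans (hz 1).symm)) (by decide)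

end Parametrization

/-! ### Automorphisms, degrees and factorization -/

section Galois

variable {M Ω : Type*} [Field M] [Field Ω] [Algebra M Ω]

/-- A Galois-stable family of distinct elements is permuted by the automorphism group. -/
lemma exists_permRep {ι : Type*} {x : ι → Ω} (hinj : Function.Injective x)
    (hx : ∀ (g : Ω ≃ₐ[M] Ω) i, ∃ j, x j = g (x i)) :
    ∃ ρ : (Ω ≃ₐ[M] Ω) →* Equiv.Perm ι, ∀ g i, x (ρ g i) = g (x i) := by
  choose f hf using hx
  let _ : MulAction (Ω ≃ₐ[M] Ω) ι :=
    { smul := f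
      one_smul := fun i => hinj (by
        change x (f 1 i) = x i
        rw [hf]; rfl)
      mul_smul := fun g h i => hinj (by
        change x (f (g * h) i) = x (f g (f h i))
        rw [hf, hf, hf]; rfl) }
  exact ⟨MulAction.toPermHom _ _, hf⟩

/-- If `ρ` is a homomorphism on the automorphism group of `Ω` whose kernel is the group fixing the
Galois extension `L`, then its range is the Galois group of `L`. -/
lemma nonempty_range_mulEquiv [Normal M Ω] (L : IntermediateField M Ω) [Normal M L] {G : Type*}
    [Group G] (ρ : (Ω ≃ₐ[M] Ω) →* G) (hρ : ρ.ker = L.fixingSubgroup) :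
    Nonempty ((L ≃ₐ[M] L) ≃* ρ.range) := by
  have h : ρ.ker = (AlgEquiv.restrictNormalHom (F := M) (K₁ := Ω) L).ker := by
    rw [hρ, IntermediateField.restrictNormalHom_ker]
  exact ⟨(QuotientGroup.quotientKerEquivOfSurjective _
    (AlgEquiv.restrictNormalHom_surjective (F := M) (K₁ := L) Ω)).symm.trans
    ((QuotientGroup.quotientMulEquivOfEq h.symm).trans (QuotientGroup.quotientKerEquivRange ρ))⟩

/-- Over `A ⊓ B` the two fields become linearly disjoint, as `A` is Galois. -/
lemma finrank_inf_mul_finrank_sup (A B : IntermediateField M Ω) [IsGalois M A]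
    [FiniteDimensional M A] [FiniteDimensional M B] :
    Module.finrank M ↥(A ⊓ B) * Module.finrank M ↥(A ⊔ B) =
      Module.finrank M A * Module.finrank M B := by
  set F := A ⊓ B with hF
  have hA : F ≤ A := inf_le_left
  have hB : F ≤ B := inf_le_right
  have tower : ∀ (E : IntermediateField M Ω) (h : F ≤ E),
      Module.finrank M F * Module.finrank F (IntermediateField.extendScalars h) =
        Module.finrank M E := fun E h =>
    have : Module.Free F (IntermediateField.extendScalars h) := Module.Free.of_divisionRing _ _
    Module.finrank_mul_finrank M F (IntermediateField.extendScalars h)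
  have i1 : IsGalois M (IntermediateField.extendScalars hA) := ‹IsGalois M A›
  have i2 : IsGalois F (IntermediateField.extendScalars hA) :=
    IsGalois.tower_top_of_isGalois M F _
  have i3 : FiniteDimensional M (IntermediateField.extendScalars hA) := ‹FiniteDimensional M A›
  have i4 : FiniteDimensional F (IntermediateField.extendScalars hA) :=
    FiniteDimensional.right M F _
  have i5 : FiniteDimensional M (IntermediateField.extendScalars hB) := ‹FiniteDimensional M B›
  have i6 : FiniteDimensional F (IntermediateField.extendScalars hB) :=
    FiniteDimensional.right M F _
  have hdis := IntermediateField.LinearDisjoint.of_inf_eq_bot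
    (A := IntermediateField.extendScalars hA) (B := IntermediateField.extendScalars hB)
    (by rw [IntermediateField.extendScalars_inf]; exact IntermediateField.extendScalars_self F)
  have h := hdis.finrank_sup
  rw [IntermediateField.extendScalars_sup] at h
  rw [← tower _ hA, ← tower _ hB, ← tower _ (hA.trans le_sup_left), h]
  ring

lemma decompType_of_prod {p : M[X]} {c : M} (hc : c ≠ 0) {s : Multiset M[X]}
    (hs : ∀ q ∈ s, Irreducible q) (hp : p = C c * s.prod) :
    decompType p = s.map natDegree := by
  have h0 : s.prod ≠ 0 := Multiset.prod_ne_zero fun h => (hs 0 h).ne_zero rfl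
  have hass : Associated p s.prod := by
    rw [hp]
    exact (associated_unit_mul_left _ _ (isUnit_C.2 hc.isUnit))
  have hp0 : p ≠ 0 := hass.ne_zero_iff.2 h0
  have hrel := UniqueFactorizationMonoid.factors_unique
    UniqueFactorizationMonoid.irreducible_of_factor hs
    ((UniqueFactorizationMonoid.factors_prod hp0).trans hass)
  rw [decompType, ← Multiset.rel_eq, Multiset.rel_map]
  exact hrel.mono fun q _ r _ h => natDegree_eq_of_degree_eq (degree_eq_degree_of_associated h)

section Orbits

variable {ι : Type*} [Fintype ι] {u : ι → Ω} {p : M[X]} {c : M}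

lemma aeval_eq_zero_iff_of_map_eq (hc : c ≠ 0)
    (hp : p.map (algebraMap M Ω) = C (algebraMap M Ω c) * ∏ i, (X - C (u i))) (r : Ω) :
    aeval r p = 0 ↔ ∃ j, u j = r := by
  rw [← eval_map_algebraMap, hp, eval_mul, eval_C, eval_prod, mul_eq_zero, Finset.prod_eq_zero_iff]
  simp [hc, sub_eq_zero, eq_comm (a := r)]

variable [Normal M Ω]

/-- Let `u` be an injective family consisting of the roots of `p`. The minimal polynomial of a
member is the product over its orbit; separability comes from `p`. -/
lemma minpoly_map_eq_prod (hinj : Function.Injective u) (hc : c ≠ 0)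
    (hp : p.map (algebraMap M Ω) = C (algebraMap M Ω c) * ∏ i, (X - C (u i))) {O : Finset ι} {i : ι}
    (hi : ∀ j, j ∈ O ↔ ∃ g : Ω ≃ₐ[M] Ω, g (u i) = u j) :
    (minpoly M (u i)).map (algebraMap M Ω) = ∏ j ∈ O, (X - C (u j)) := by
  have hc' : algebraMap M Ω c ≠ 0 := (_root_.map_ne_zero _).2 hc
  have hmem := aeval_eq_zero_iff_of_map_eq hc hp
  have hroots : (p.map (algebraMap M Ω)).roots = Finset.univ.val.map u := by
    rw [hp, roots_C_mul _ hc']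
    exact roots_multiset_prod_X_sub_C (Finset.univ.val.map u) ▸ by
      rw [Multiset.map_map]; rfl
  have hp0 : p.map (algebraMap M Ω) ≠ 0 := by
    rw [hp]
    exact mul_ne_zero (C_ne_zero.2 hc') (Finset.prod_ne_zero_iff.2 fun i _ => X_sub_C_ne_zero _)
  have hint : IsIntegral M (u i) := Normal.isIntegral ‹_› _
  have hdvd : minpoly M (u i) ∣ p := minpoly.dvd _ _ ((hmem _).2 ⟨i, rfl⟩)
  have hμ0 : (minpoly M (u i)).map (algebraMap M Ω) ≠ 0 := ((minpoly.monic hint).map _).ne_zero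
  have hle : ((minpoly M (u i)).map (algebraMap M Ω)).roots ≤ Finset.univ.val.map u := by
    rw [← hroots]
    exact roots.le_of_dvd hp0 (Polynomial.map_dvd _ hdvd)
  have hnd : ((minpoly M (u i)).map (algebraMap M Ω)).roots.Nodup :=
    Multiset.nodup_of_le hle (Finset.univ.nodup.map hinj)
  have hr : ((minpoly M (u i)).map (algebraMap M Ω)).roots = O.val.map u := by
    rw [Multiset.Nodup.ext hnd (O.nodup.map hinj)]
    intro r
    rw [mem_roots hμ0, IsRoot, eval_map_algebraMap, Multiset.mem_map]
    constructor
    · intro h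
      have hrp : aeval r p = 0 := aeval_eq_zero_of_dvd_aeval_eq_zero hdvd h
      obtain ⟨j, rfl⟩ := (hmem r).1 hrp
      have hmin : minpoly M (u j) = minpoly M (u i) :=
        (minpoly.eq_of_irreducible_of_monic (minpoly.irreducible hint) h
          (minpoly.monic hint)).symm
      obtain ⟨g, hg⟩ := Normal.minpoly_eq_iff_mem_orbit (E := Ω) |>.1 hmin
      exact ⟨j, (hi j).2 ⟨g, hg⟩, rfl⟩
    · rintro ⟨j, hj, rfl⟩
      obtain ⟨g, hg⟩ := (hi j).1 hj
      rw [← hg, aeval_algHom_apply, minpoly.aeval, map_zero]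
  have hs := (Normal.splits ‹Normal M Ω› (u i)).eq_prod_roots
  rw [((minpoly.monic hint).map _).leadingCoeff, C_1, one_mul, hr, Multiset.map_map] at hs
  exact hs

/-- A member of the family that is fixed by all automorphisms lies in the base field. This is not
automatic, as `Ω` may be inseparable over `M`. -/
lemma mem_range_algebraMap_of_fixed (hinj : Function.Injective u) (hc : c ≠ 0)
    (hp : p.map (algebraMap M Ω) = C (algebraMap M Ω c) * ∏ i, (X - C (u i))) {i : ι}
    (hfix : ∀ g : Ω ≃ₐ[M] Ω, g (u i) = u i) : u i ∈ (algebraMap M Ω).range := by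
  have h := minpoly_map_eq_prod hinj hc hp (O := {i}) (i := i) fun j => by
    simp [hfix, hinj.eq_iff, eq_comm]
  have hdeg := congrArg natDegree h
  rw [natDegree_map, Finset.prod_singleton, natDegree_X_sub_C] at hdeg
  exact minpoly.natDegree_eq_one_iff.1 hdeg

/-- If `u` is an injective family consisting of the roots of `p`, then the irreducible factors
of `p` correspond to the orbits of the automorphism group on the indices. -/
lemma decompType_eq (hinj : Function.Injective u) (hc : c ≠ 0)
    (hp : p.map (algebraMap M Ω) = C (algebraMap M Ω c) * ∏ i, (X - C (u i)))
    (parts : Multiset (Finset ι)) (hparts : (parts.map Finset.val).sum = Finset.univ.val)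
    (horb : ∀ O ∈ parts, ∃ i, ∀ j, j ∈ O ↔ ∃ g : Ω ≃ₐ[M] Ω, g (u i) = u j) :
    decompType p = parts.map Finset.card := by
  have hfac : ∀ O ∈ parts, ∃ q : M[X], Irreducible q ∧
      q.map (algebraMap M Ω) = ∏ i ∈ O, (X - C (u i)) := by
    intro O hO
    obtain ⟨i, hi⟩ := horb O hO
    exact ⟨_, minpoly.irreducible (Normal.isIntegral ‹_› _), minpoly_map_eq_prod hinj hc hp hi⟩
  choose! q hq using hfac
  have hdeg : ∀ O ∈ parts, (q O).natDegree = O.card := by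
    intro O hO
    rw [← natDegree_map (algebraMap M Ω), (hq O hO).2, natDegree_prod_of_monic _ _
      fun i _ => monic_X_sub_C _]
    simp
  rw [decompType_of_prod hc (s := parts.map q), Multiset.map_map]
  · exact Multiset.map_congr rfl hdeg
  · intro r hr
    obtain ⟨O, hO, rfl⟩ := Multiset.mem_map.1 hr
    exact (hq O hO).1
  · apply map_injective _ (algebraMap M Ω).injective
    rw [hp, Polynomial.map_mul, map_C, Polynomial.map_multiset_prod, Multiset.map_map]
    congr 1
    have h1 : parts.map (Polynomial.map (algebraMap M Ω) ∘ q) =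
        parts.map fun O => (O.val.map fun i => X - C (u i)).prod :=
      Multiset.map_congr rfl fun O hO => (hq O hO).2
    change (Finset.univ.val.map fun i => X - C (u i)).prod = _
    rw [h1, ← hparts]
    clear h1 hparts horb hdeg hq
    induction parts using Multiset.induction_on with
    | empty => simp
    | cons O s ih => simp only [Multiset.map_cons, Multiset.sum_cons, Multiset.map_add,
        Multiset.prod_add, Multiset.prod_cons, ih]

end Orbits

end Galois

/-! ### The roots of the cubic and its splitting field -/

section Roots

variable {M : Type*} [Field M]

lemma cubic_natDegree (s : M) : (cubic s).natDegree = 3 := by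
  unfold cubic; compute_degree!

lemma cubic_monic (s : M) : (cubic s).Monic := by
  unfold cubic; monicity!

lemma ne_zero_of_separable {s : M} (h : (cubic s).Separable) : s ≠ 0 := by
  rintro rfl
  have : (X ^ 3 : M[X]).Separable := by simpa [cubic] using h
  have := this.squarefree
  exact not_isUnit_X (this X ⟨X, by ring⟩)

variable {Ω : Type*} [Field Ω] [Algebra M Ω]

lemma aeval_cubic (s : M) (r : Ω) :
    aeval r (cubic s) = r ^ 3 + algebraMap M Ω s * r + algebraMap M Ω s := by
  simp [cubic]

lemma aeval_H (a b : M) (u : Ω) :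
    aeval u (H a b) = algebraMap M Ω a * (u ^ 2 + 9 * u - 3 * algebraMap M Ω a) ^ 3 -
      algebraMap M Ω b * (u ^ 3 - 2 * algebraMap M Ω a * u ^ 2 - 9 * algebraMap M Ω a * u -
        2 * algebraMap M Ω a ^ 2 - 27 * algebraMap M Ω a) ^ 2 := by
  simp only [H, map_sub, _root_.map_mul, _root_.map_pow, map_add, aeval_C, aeval_X,
    _root_.map_ofNat]
  ring

lemma H_natDegree {a b : M} (hab : a ≠ b) : (H a b).natDegree = 6 ∧ (H a b).leadingCoeff = a - b := by
  have h1 : (H a b).natDegree ≤ 6 := by unfold H; compute_degree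
  have h2 : (H a b).coeff 6 = a - b := by unfold H; compute_degree!
  have h3 : (H a b).natDegree = 6 :=
    natDegree_eq_of_le_of_coeff_ne_zero h1 (by rw [h2]; exact sub_ne_zero.2 hab)
  exact ⟨h3, by rw [leadingCoeff, h3, h2]⟩

variable [IsAlgClosure M Ω]

lemma cubic_splits (s : M) : ((cubic s).map (algebraMap M Ω)).Splits :=
  have := IsAlgClosure.isAlgClosed M (K := Ω)
  IsAlgClosed.splits _

/-- An enumeration of the roots of `X³ + sX + s`. -/
lemma exists_roots {s : M} (hs : (cubic s).Separable) :
    ∃ x : Fin 3 → Ω, Function.Injective x ∧ Set.range x = (cubic s).rootSet Ω := by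
  have hcard := card_rootSet_eq_natDegree (K := Ω) hs (cubic_splits s)
  rw [cubic_natDegree] at hcard
  let e := (Fintype.equivFinOfCardEq hcard).symm
  exact ⟨fun i => e i, Subtype.val_injective.comp e.injective, by
    rw [Set.range_comp' Subtype.val e, e.surjective.range_eq, Set.image_univ, Subtype.range_coe]⟩

lemma mem_rootSet_cubic {s : M} {r : Ω} :
    r ∈ (cubic s).rootSet Ω ↔ r ^ 3 + algebraMap M Ω s * r + algebraMap M Ω s = 0 := by
  rw [mem_rootSet, aeval_cubic]
  exact and_iff_right (cubic_monic s).ne_zero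

lemma isSplittingField_Spl (s : M) :
    IsSplittingField M (Spl M Ω (cubic s)) (cubic s) :=
  IntermediateField.adjoin_rootSet_isSplittingField (cubic_splits s)

lemma isGalois_Spl {s : M} (hs : (cubic s).Separable) : IsGalois M (Spl M Ω (cubic s)) :=
  have := isSplittingField_Spl (Ω := Ω) s
  IsGalois.of_separable_splitting_field hs

lemma finiteDimensional_Spl (s : M) : FiniteDimensional M (Spl M Ω (cubic s)) :=
  have := isSplittingField_Spl (Ω := Ω) s
  IsSplittingField.finiteDimensional _ (cubic s)

/-- The action of the automorphism group on the roots of `X³ + sX + s`; its kernel is the group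
fixing the splitting field. -/
lemma exists_permRep_roots {s : M} {x : Fin 3 → Ω} (hinj : Function.Injective x)
    (hx : Set.range x = (cubic s).rootSet Ω) :
    ∃ ρ : (Ω ≃ₐ[M] Ω) →* S₃, (∀ g i, x (ρ g i) = g (x i)) ∧
      ρ.ker = (Spl M Ω (cubic s)).fixingSubgroup := by
  obtain ⟨ρ, hρ⟩ := exists_permRep (M := M) hinj fun g i => by
    have h : x i ∈ (cubic s).rootSet Ω := hx ▸ ⟨i, rfl⟩
    have h2 : g (x i) ∈ (cubic s).rootSet Ω := by
      rw [mem_rootSet] at h ⊢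
      exact ⟨h.1, by rw [aeval_algHom_apply, h.2, map_zero]⟩
    rw [← hx] at h2
    exact h2
  refine ⟨ρ, hρ, ?_⟩
  ext g
  have h1 : g ∈ (Spl M Ω (cubic s)).fixingSubgroup ↔ ∀ i, g (x i) = x i := by
    rw [Spl, ← hx]
    constructor
    · intro h i
      exact (IntermediateField.mem_fixingSubgroup_iff _ _).1 h _
        (IntermediateField.subset_adjoin _ _ ⟨i, rfl⟩)
    · intro h
      rw [← Subgroup.zpowers_le, ← IntermediateField.le_iff_le, IntermediateField.adjoin_le_iff]
      rintro _ ⟨i, rfl⟩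
      have : Subgroup.zpowers g ≤ MulAction.stabilizer (Ω ≃ₐ[M] Ω) (x i) := by
        rw [Subgroup.zpowers_le]; exact h i
      exact fun k => this k.2
  rw [h1, MonoidHom.mem_ker]
  constructor
  · intro h i
    rw [← hρ, h]; rfl
  · intro h
    ext i
    exact congrArg Fin.val (hinj ((hρ g i).trans (h i)))

end Roots

/-! ### The joint Galois group of the two cubics -/

/-- There is a subgroup `K ≤ S₃ × S₃`, the image of the Galois group acting on the roots of both
cubics at once, such that the projections of `K` are the two Galois groups, the orbits of `K` on
the bijections between the two sets of roots give the factorization of `H`, and an equivariant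
bijection exists exactly when `H` has a root in `M`. -/
lemma exists_jointGroup {M Ω : Type*} [Field M] [Field Ω] [Algebra M Ω] [IsAlgClosure M Ω]
    {a b : M} (hab : a ≠ b) (ha : (cubic a).Separable) (hb : (cubic b).Separable) :
    ∃ K : Subgroup (S₃ × S₃),
      Nonempty ((Spl M Ω (cubic a) ≃ₐ[M] Spl M Ω (cubic a)) ≃* K.map (MonoidHom.fst S₃ S₃)) ∧
      Nonempty ((Spl M Ω (cubic b) ≃ₐ[M] Spl M Ω (cubic b)) ≃* K.map (MonoidHom.snd S₃ S₃)) ∧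
      Nat.card K = Module.finrank M ↥(Spl M Ω (cubic a) ⊔ Spl M Ω (cubic b)) ∧
      (∀ d, OrbitType K d → decompType (H a b) = d) ∧
      ((∃ φ, ∀ k ∈ K, k.2 = φ * k.1 * φ⁻¹) ↔
        ∃ u : M, u ^ 3 - 2 * a * u ^ 2 - 9 * a * u - 2 * a ^ 2 - 27 * a ≠ 0 ∧
        b = a * (u ^ 2 + 9 * u - 3 * a) ^ 3 /
          (u ^ 3 - 2 * a * u ^ 2 - 9 * a * u - 2 * a ^ 2 - 27 * a) ^ 2) := by
  have : Normal M Ω := IsAlgClosure.normal M Ω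
  have iGa := isGalois_Spl (Ω := Ω) ha
  have iGb := isGalois_Spl (Ω := Ω) hb
  have iFa := finiteDimensional_Spl (Ω := Ω) a
  have iFb := finiteDimensional_Spl (Ω := Ω) b
  obtain ⟨x, hxinj, hxr⟩ := exists_roots (Ω := Ω) ha
  obtain ⟨z, hzinj, hzr⟩ := exists_roots (Ω := Ω) hb
  have hx : ∀ i, x i ^ 3 + algebraMap M Ω a * x i + algebraMap M Ω a = 0 := fun i =>
    mem_rootSet_cubic.1 (hxr ▸ ⟨i, rfl⟩)
  have hz : ∀ i, z i ^ 3 + algebraMap M Ω b * z i + algebraMap M Ω b = 0 := fun i =>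
    mem_rootSet_cubic.1 (hzr ▸ ⟨i, rfl⟩)
  obtain ⟨ρa, hρa, hka⟩ := exists_permRep_roots (M := M) hxinj hxr
  obtain ⟨ρb, hρb, hkb⟩ := exists_permRep_roots (M := M) hzinj hzr
  have hb0 := ne_zero_of_separable hb
  set a' := algebraMap M Ω a with ha'
  set b' := algebraMap M Ω b with hb'
  have hab' : a' ≠ b' := fun h => hab ((algebraMap M Ω).injective h)
  have hb0' : b' ≠ 0 := (_root_.map_ne_zero _).2 hb0
  have hpar : ∀ φ : S₃, ∃ u β : Ω, ∀ i, z (φ i) = β * (u * x i + 3 * x i ^ 2 + 2 * a') := fun φ =>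
    exists_param (z := z ∘ φ) hxinj (hzinj.comp φ.injective) hx (fun i => hz _) hab' hb0'
  choose u β hu using hpar
  obtain ⟨vx1, vx2, vx3⟩ := vieta hxinj hx
  have hpe : ∀ φ, b' = β φ ^ 2 * (a' * (u φ ^ 2 + 9 * u φ - 3 * a')) ∧
      b' = β φ ^ 3 * (a' * (u φ ^ 3 - 2 * a' * u φ ^ 2 - 9 * a' * u φ - 2 * a' ^ 2 - 27 * a')) := by
    intro φ
    obtain ⟨-, vz2, vz3⟩ := vieta (x := z ∘ φ) (s := b') (hzinj.comp φ.injective) fun i => hz _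
    exact param_eq vx1 vx2 vx3 vz2 vz3 (hu φ)
  have hβ0 : ∀ φ, β φ ≠ 0 := by
    intro φ h
    have := (hpe φ).1
    rw [h] at this
    exact hb0' (by simpa using this)
  have hQ0 : ∀ φ, u φ ^ 3 - 2 * a' * u φ ^ 2 - 9 * a' * u φ - 2 * a' ^ 2 - 27 * a' ≠ 0 := by
    intro φ h
    have := (hpe φ).2
    rw [h] at this
    exact hb0' (by simpa using this)
  have ha0' : a' ≠ 0 := (_root_.map_ne_zero _).2 (ne_zero_of_separable ha)
  have hβu : ∀ φ, β φ * (u φ ^ 3 - 2 * a' * u φ ^ 2 - 9 * a' * u φ - 2 * a' ^ 2 - 27 * a') =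
      u φ ^ 2 + 9 * u φ - 3 * a' := by
    intro φ
    apply mul_left_cancel₀ (mul_ne_zero (pow_ne_zero 2 (hβ0 φ)) ha0')
    linear_combination (hpe φ).1 - (hpe φ).2
  -- By the two equations for `b`, the scaling factor is `P(u) / Q(u)`, so `u` determines the
  -- bijection.
  have hinj : Function.Injective u := by
    intro φ ψ h
    have h1 : β φ = β ψ := by
      apply mul_right_cancel₀ (hQ0 φ)
      rw [hβu φ, h, hβu ψ]
    ext i
    exact congrArg Fin.val (hzinj (by rw [hu φ, hu ψ, h1, h]))
  have hH0 : ∀ φ, aeval (u φ) (H a b) = 0 := by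
    intro φ
    rw [aeval_H, ← ha', ← hb', ← hβu φ]
    linear_combination (-(u φ ^ 3 - 2 * a' * u φ ^ 2 - 9 * a' * u φ - 2 * a' ^ 2 - 27 * a') ^ 2) *
      (hpe φ).2
  -- The six values `u φ` are roots of `H`, which has degree six.
  have hHmap : (H a b).map (algebraMap M Ω) =
      C (algebraMap M Ω (a - b)) * ∏ φ, (X - C (u φ)) := by
    obtain ⟨hdeg, hlc⟩ := H_natDegree hab
    have hne : (H a b).map (algebraMap M Ω) ≠ 0 := by
      rw [Polynomial.map_ne_zero_iff (algebraMap M Ω).injective]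
      rintro h
      rw [h, natDegree_zero] at hdeg
      omega
    have hle : Finset.univ.val.map u ≤ ((H a b).map (algebraMap M Ω)).roots := by
      rw [Multiset.le_iff_subset (Finset.univ.nodup.map hinj)]
      intro r hr
      obtain ⟨φ, -, rfl⟩ := Multiset.mem_map.1 hr
      rw [mem_roots hne, IsRoot, eval_map_algebraMap, hH0]
    have hcard : Multiset.card (Finset.univ.val.map u) = 6 := by
      rw [Multiset.card_map]; decide
    have hcard2 : Multiset.card ((H a b).map (algebraMap M Ω)).roots ≤ 6 := by
      refine (card_roots' _).trans ?_
      rw [natDegree_map, hdeg]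
    have heq := Multiset.eq_of_le_of_card_le hle (by rw [hcard]; exact hcard2)
    have h := C_leadingCoeff_mul_prod_multiset_X_sub_C (p := (H a b).map (algebraMap M Ω))
      (by rw [← heq, hcard, natDegree_map, hdeg])
    rw [← heq, leadingCoeff_map, hlc, Multiset.map_map] at h
    exact h.symm
  have hc : a - b ≠ 0 := sub_ne_zero.2 hab
  have hequi : ∀ (g : Ω ≃ₐ[M] Ω) φ, g (u φ) = u (ρb g * φ * (ρa g)⁻¹) := by
    intro g φ
    symm
    refine param_unique hxinj hx (hβ0 _) (hu (ρb g * φ * (ρa g)⁻¹)) (β' := g (β φ)) fun i => ?_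
    obtain ⟨i, rfl⟩ := (ρa g).surjective i
    rw [← Equiv.Perm.mul_apply, inv_mul_cancel_right, Equiv.Perm.mul_apply, hρb, hρa, hu φ]
    simp [ha', _root_.map_ofNat]
  set K := (ρa.prod ρb).range with hK
  have hKa : K.map (MonoidHom.fst S₃ S₃) = ρa.range := by
    rw [hK, ← MonoidHom.range_comp, MonoidHom.fst_comp_prod]
  have hKb : K.map (MonoidHom.snd S₃ S₃) = ρb.range := by
    rw [hK, ← MonoidHom.range_comp, MonoidHom.snd_comp_prod]
  refine ⟨K, ?_, ?_, ?_, ?_, ?_⟩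
  · rw [hKa]; exact nonempty_range_mulEquiv _ ρa hka
  · rw [hKb]; exact nonempty_range_mulEquiv _ ρb hkb
  · obtain ⟨e⟩ := nonempty_range_mulEquiv (Spl M Ω (cubic a) ⊔ Spl M Ω (cubic b)) (ρa.prod ρb) (by
      rw [MonoidHom.ker_prod, hka, hkb, IntermediateField.fixingSubgroup_sup])
    rw [← Nat.card_congr e.toEquiv, IsGalois.card_aut_eq_finrank]
  · rintro d ⟨parts, hparts, horb, rfl⟩
    refine decompType_eq hinj hc hHmap parts hparts fun O hO => ?_
    obtain ⟨i, hi⟩ := horb O hO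
    refine ⟨i, fun j => (hi j).trans ?_⟩
    constructor
    · rintro ⟨_, ⟨g, rfl⟩, rfl⟩
      exact ⟨g, hequi g i⟩
    · rintro ⟨g, hg⟩
      exact ⟨_, ⟨g, rfl⟩, hinj ((hequi g i).symm.trans hg)⟩
  · have hfix : ∀ φ, (∀ k ∈ K, k.2 = φ * k.1 * φ⁻¹) ↔ ∀ g : Ω ≃ₐ[M] Ω, g (u φ) = u φ := by
      intro φ
      have h1 : (∀ k ∈ K, k.2 = φ * k.1 * φ⁻¹) ↔ ∀ g, ρb g = φ * ρa g * φ⁻¹ :=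
        ⟨fun h g => h _ ⟨g, rfl⟩, by rintro h _ ⟨g, rfl⟩; exact h g⟩
      rw [h1]
      refine forall_congr' fun g => ?_
      rw [hequi, hinj.eq_iff, eq_mul_inv_iff_mul_eq, mul_inv_eq_iff_eq_mul]
    constructor
    · rintro ⟨φ, hφ⟩
      obtain ⟨v, hv⟩ := mem_range_algebraMap_of_fixed hinj hc hHmap ((hfix φ).1 hφ)
      have hQ : v ^ 3 - 2 * a * v ^ 2 - 9 * a * v - 2 * a ^ 2 - 27 * a ≠ 0 := by
        intro h
        apply hQ0 φ
        rw [← hv, ha']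
        simpa [_root_.map_ofNat] using congrArg (algebraMap M Ω) h
      refine ⟨v, hQ, ?_⟩
      rw [eq_div_iff (pow_ne_zero 2 hQ)]
      apply (algebraMap M Ω).injective
      have h := hH0 φ
      rw [aeval_H, ← hv, sub_eq_zero] at h
      simpa [_root_.map_ofNat] using h.symm
    · rintro ⟨v, hQ, hv⟩
      rw [eq_div_iff (pow_ne_zero 2 hQ)] at hv
      have h0 : aeval (algebraMap M Ω v) (H a b) = 0 := by
        rw [aeval_H, sub_eq_zero]
        simpa [_root_.map_ofNat] using (congrArg (algebraMap M Ω) hv).symm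
      obtain ⟨φ, hφ⟩ := (aeval_eq_zero_iff_of_map_eq hc hHmap _).1 h0
      exact ⟨φ, (hfix φ).2 fun g => by rw [hφ, AlgEquiv.commutes]⟩

/-! ### From degrees to groups -/

section Groups

variable {M Ω : Type*} [Field M] [Field Ω] [Algebra M Ω] {L : IntermediateField M Ω}

lemma finrank_eq_of_hasGroup [IsGalois M L] [FiniteDimensional M L] {G : Type} [Group G] {n : ℕ}
    (h : HasGroup L G) (hn : Nat.card G = n) : Module.finrank M L = n := by
  obtain ⟨e⟩ := h
  rw [← IsGalois.card_aut_eq_finrank, Nat.card_congr e.toEquiv, hn]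

lemma card_S₃ : Nat.card S₃ = 6 := by simp [Fintype.card_perm, Nat.factorial]

lemma card_Cyc (n : ℕ) : Nat.card (Cyc n) = n := by
  rw [Nat.card_congr Multiplicative.toAdd, Nat.card_zmod]

/-- A group that embeds into `S₃` is determined by its order. -/
lemma hasGroup_of_card {P : Subgroup S₃} (e : Nonempty ((L ≃ₐ[M] L) ≃* P)) :
    (Nat.card P = 6 → HasGroup L S₃) ∧ (Nat.card P = 3 → HasGroup L (Cyc 3)) ∧
      (Nat.card P = 2 → HasGroup L (Cyc 2)) ∧ (Nat.card P = 1 → HasGroup L (Cyc 1)) := by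
  obtain ⟨e⟩ := e
  have hprime : ∀ p, p.Prime → Nat.card P = p → HasGroup L (Cyc p) := fun p hp h => by
    have := Fact.mk hp
    exact ⟨e.trans (mulEquivOfPrimeCardEq h (card_Cyc p))⟩
  refine ⟨fun h => ?_, hprime 3 Nat.prime_three, hprime 2 Nat.prime_two, fun h => ?_⟩
  · have htop : P = ⊤ := Subgroup.eq_top_of_card_eq _ (h.trans card_S₃.symm)
    subst htop
    exact ⟨e.trans Subgroup.topEquiv⟩
  · have h1 : Subsingleton P := (Nat.card_eq_one_iff_unique.1 h).1
    have h2 : Subsingleton (Cyc 1) := (Nat.card_eq_one_iff_unique.1 (card_Cyc 1)).1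
    exact ⟨e.trans (mulEquivOfCyclicCardEq (h.trans (card_Cyc 1).symm))⟩

lemma three_dvd_finrank [IsAlgClosure M Ω] {a : M} (hirr : Irreducible (cubic a))
    (ha : (cubic a).Separable) : 3 ∣ Module.finrank M (Spl M Ω (cubic a)) := by
  obtain ⟨x, -, hx⟩ := exists_roots (Ω := Ω) ha
  have hmem : x 0 ∈ (cubic a).rootSet Ω := hx ▸ ⟨0, rfl⟩
  have h0 : aeval (x 0) (cubic a) = 0 := (mem_rootSet.1 hmem).2
  have hint : IsIntegral M (x 0) := ⟨cubic a, cubic_monic a, h0⟩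
  have hle : IntermediateField.adjoin M {x 0} ≤ Spl M Ω (cubic a) :=
    IntermediateField.adjoin_simple_le_iff.2 (IntermediateField.subset_adjoin _ _ hmem)
  have hfin := IntermediateField.adjoin.finrank hint
  rw [← minpoly.eq_of_irreducible_of_monic hirr h0 (cubic_monic a), cubic_natDegree] at hfin
  rw [← hfin]
  exact IntermediateField.finrank_dvd_of_le_right hle

end Groups

end CubicSubfield

open CubicSubfield

theorem theorem4p10 {M : Type*} [Field M] (hchar : ringChar M ≠ 3)
    {Ω : Type*} [Field Ω] [Algebra M Ω] [IsAlgClosure M Ω]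
    (a b : M) (hab : a ≠ b)
    (ha : (CubicSubfield.cubic a).Separable) (hb : (CubicSubfield.cubic b).Separable)
    (La Lb : IntermediateField M Ω)
    (hLa : La = CubicSubfield.Spl M Ω (CubicSubfield.cubic a))
    (hLb : Lb = CubicSubfield.Spl M Ω (CubicSubfield.cubic b))
    (d : Multiset ℕ) (hd : d = CubicSubfield.decompType (CubicSubfield.H a b)) :
    -- the table, for `X³ + aX + a` irreducible over `M`
    (Irreducible (CubicSubfield.cubic a) →
      -- the possible Galois groups
      (CubicSubfield.HasGroup La CubicSubfield.S₃ ∨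
        CubicSubfield.HasGroup La (CubicSubfield.Cyc 3)) ∧
      (CubicSubfield.HasGroup Lb CubicSubfield.S₃ ∨
        CubicSubfield.HasGroup Lb (CubicSubfield.Cyc 3) ∨
        CubicSubfield.HasGroup Lb (CubicSubfield.Cyc 2) ∨
        CubicSubfield.HasGroup Lb (CubicSubfield.Cyc 1)) ∧
      -- groups `S₃`, `S₃`
      (CubicSubfield.HasGroup La CubicSubfield.S₃ →
        CubicSubfield.HasGroup Lb CubicSubfield.S₃ →
          (d = {6} ∨ d = {3, 3} ∨ d = {1, 2, 3}) ∧
          ((La ≠ Lb ∧ La ⊓ Lb = ⊥) ↔ d = {6}) ∧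
          ((La ≠ Lb ∧ Module.finrank M ↥(La ⊓ Lb) = 2) ↔ d = {3, 3}) ∧
          (La = Lb ↔ d = {1, 2, 3})) ∧
      -- groups `S₃`, `C₃`
      (CubicSubfield.HasGroup La CubicSubfield.S₃ →
        CubicSubfield.HasGroup Lb (CubicSubfield.Cyc 3) →
          La ⊓ Lb = ⊥ ∧ d = {6}) ∧
      -- groups `S₃`, `C₂`
      (CubicSubfield.HasGroup La CubicSubfield.S₃ →
        CubicSubfield.HasGroup Lb (CubicSubfield.Cyc 2) →
          (¬ Lb ≤ La ↔ d = {6}) ∧ (Lb ≤ La ↔ d = {3, 3})) ∧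
      -- groups `S₃`, `{1}`
      (CubicSubfield.HasGroup La CubicSubfield.S₃ →
        CubicSubfield.HasGroup Lb (CubicSubfield.Cyc 1) →
          Lb ≤ La ∧ d = {6}) ∧
      -- groups `C₃`, `C₃`
      (CubicSubfield.HasGroup La (CubicSubfield.Cyc 3) →
        CubicSubfield.HasGroup Lb (CubicSubfield.Cyc 3) →
          (La ≠ Lb ↔ d = {3, 3}) ∧ (La = Lb ↔ d = {1, 1, 1, 3})) ∧
      -- groups `C₃`, `C₂`
      (CubicSubfield.HasGroup La (CubicSubfield.Cyc 3) →
        CubicSubfield.HasGroup Lb (CubicSubfield.Cyc 2) →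
          La ⊓ Lb = ⊥ ∧ d = {6}) ∧
      -- groups `C₃`, `{1}`
      (CubicSubfield.HasGroup La (CubicSubfield.Cyc 3) →
        CubicSubfield.HasGroup Lb (CubicSubfield.Cyc 1) →
          Lb ≤ La ∧ d = {3, 3})) ∧
    -- coincidence of the two splitting fields
    (La = Lb ↔
      ∃ u : M, u ^ 3 - 2 * a * u ^ 2 - 9 * a * u - 2 * a ^ 2 - 27 * a ≠ 0 ∧
        b = a * (u ^ 2 + 9 * u - 3 * a) ^ 3 /
          (u ^ 3 - 2 * a * u ^ 2 - 9 * a * u - 2 * a ^ 2 - 27 * a) ^ 2) := by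
  have iGa : IsGalois M La := hLa ▸ isGalois_Spl (Ω := Ω) ha
  have iGb : IsGalois M Lb := hLb ▸ isGalois_Spl (Ω := Ω) hb
  have iFa : FiniteDimensional M La := hLa ▸ finiteDimensional_Spl (Ω := Ω) a
  have iFb : FiniteDimensional M Lb := hLb ▸ finiteDimensional_Spl (Ω := Ω) b
  obtain ⟨K, hKa, hKb, hm, horb, hfix⟩ := exists_jointGroup (Ω := Ω) hab ha hb
  rw [← hLa] at hKa hm
  rw [← hLb] at hKb hm
  have hprod := finrank_inf_mul_finrank_sup La Lb
  have hna : Nat.card (K.map (MonoidHom.fst S₃ S₃)) = Module.finrank M La := by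
    obtain ⟨e⟩ := hKa
    rw [← Nat.card_congr e.toEquiv, IsGalois.card_aut_eq_finrank]
  have hnb : Nat.card (K.map (MonoidHom.snd S₃ S₃)) = Module.finrank M Lb := by
    obtain ⟨e⟩ := hKb
    rw [← Nat.card_congr e.toEquiv, IsGalois.card_aut_eq_finrank]
  have hA := card_leftKer_mul K
  have hB := card_rightKer_mul K
  have hga := hasGroup_of_card hKa
  have hgb := hasGroup_of_card hKb
  have h6a : Nat.card (K.map (MonoidHom.fst S₃ S₃)) ∣ 6 :=
    card_S₃ ▸ Subgroup.card_subgroup_dvd_card _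
  have h6b : Nat.card (K.map (MonoidHom.snd S₃ S₃)) ∣ 6 :=
    card_S₃ ▸ Subgroup.card_subgroup_dvd_card _
  have hA2 := card_leftKer_ne_two K
  have hle_a : Lb ≤ La ↔ Module.finrank M ↥(La ⊔ Lb) = Module.finrank M La := by
    constructor
    · intro h; rw [sup_eq_left.2 h]
    · intro h
      rw [IntermediateField.eq_of_le_of_finrank_eq (le_sup_left : La ≤ La ⊔ Lb) h.symm]
      exact le_sup_right
  have hle_b : La ≤ Lb ↔ Module.finrank M ↥(La ⊔ Lb) = Module.finrank M Lb := by
    constructor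
    · intro h; rw [sup_eq_right.2 h]
    · intro h
      rw [IntermediateField.eq_of_le_of_finrank_eq (le_sup_right : Lb ≤ La ⊔ Lb) h.symm]
      exact le_sup_left
  have hbot : La ⊓ Lb = ⊥ ↔ Module.finrank M ↥(La ⊓ Lb) = 1 :=
    IntermediateField.finrank_eq_one_iff.symm
  have hpa : 0 < Module.finrank M La := Module.finrank_pos
  have hpb : 0 < Module.finrank M Lb := Module.finrank_pos
  have heq : La = Lb ↔ Nat.card (leftKer K) = 1 ∧ Nat.card (rightKer K) = 1 := by
    have eA : Nat.card (leftKer K) = 1 ↔ Nat.card K = Module.finrank M Lb := by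
      rw [← hA, hnb, Nat.mul_eq_right hpb.ne']
    have eB : Nat.card (rightKer K) = 1 ↔ Nat.card K = Module.finrank M La := by
      rw [← hB, hna, Nat.mul_eq_right hpa.ne']
    rw [le_antisymm_iff, hle_a, hle_b, eA, eB, hm]
  rw [← hd] at horb
  refine ⟨fun hirr => ?_, ?_⟩
  -- With `A` and `B` the orders of the two kernels, `n₁` and `n₂` the degrees of `La` and `Lb`, `m`
  -- that of the compositum and `f` that of the intersection, `A n₂ = m = B n₁` and `f m = n₁ n₂`.
  · have h3 : 3 ∣ Module.finrank M La := hLa ▸ three_dvd_finrank (Ω := Ω) hirr ha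
    have hd6 := fun h3 h2 => horb _ (orbitType_six K h3 h2)
    have hd33 := fun h3 hl hr => horb _ (orbitType_three_three K h3 hl hr)
    have hd123 := fun hl hr h6 => horb _ (orbitType_of_card_eq_six K hl hr h6)
    have hd1113 := fun hl hr h3 => horb _ (orbitType_of_card_eq_three K hl hr h3)
    simp only [ne_eq, hle_a, heq, hbot]
    have hSa := fun h : HasGroup La S₃ => finrank_eq_of_hasGroup h card_S₃
    have hCa := fun h : HasGroup La (Cyc 3) => finrank_eq_of_hasGroup h (card_Cyc 3)
    have hSb := fun h : HasGroup Lb S₃ => finrank_eq_of_hasGroup h card_S₃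
    have hCb := fun h : HasGroup Lb (Cyc 3) => finrank_eq_of_hasGroup h (card_Cyc 3)
    have hCb2 := fun h : HasGroup Lb (Cyc 2) => finrank_eq_of_hasGroup h (card_Cyc 2)
    have hCb1 := fun h : HasGroup Lb (Cyc 1) => finrank_eq_of_hasGroup h (card_Cyc 1)
    rw [hna] at hB hga h6a hA2 hd123 hd1113
    rw [hnb] at hA hgb h6b
    rw [← hm] at hprod ⊢
    generalize Module.finrank M La = n₁ at *
    generalize Module.finrank M Lb = n₂ at *
    generalize Module.finrank M ↥(La ⊓ Lb) = f at *
    generalize Nat.card (leftKer K) = A at *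
    generalize Nat.card (rightKer K) = B at *
    generalize Nat.card K = m at *
    have hn₁ : n₁ = 3 ∨ n₁ = 6 := by
      have := Nat.le_of_dvd (by norm_num) h6a
      interval_cases n₁ <;> omega
    have hn₂ : n₂ = 1 ∨ n₂ = 2 ∨ n₂ = 3 ∨ n₂ = 6 := by
      have := Nat.le_of_dvd (by norm_num) h6b
      interval_cases n₂ <;> omega
    refine ⟨?_, ?_, ?_, ?_, ?_, ?_, ?_, ?_, ?_⟩
    · exact hn₁.symm.imp hga.1 hga.2.1
    · rcases hn₂ with h | h | h | h
      exacts [.inr (.inr (.inr (hgb.2.2.2 h))), .inr (.inr (.inl (hgb.2.2.1 h))),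
        .inr (.inl (hgb.2.1 h)), .inl (hgb.1 h)]
    · intro g₁ g₂
      obtain rfl := hSa g₁
      obtain rfl := hSb g₂
      have hAB : A = B := by omega
      have hfA : f * A = 6 := by rw [← hA, ← mul_assoc] at hprod; omega
      have hA6 : A ∣ 6 := ⟨f, by rw [mul_comm, hfA]⟩
      have := Nat.le_of_dvd (by norm_num) hA6
      obtain h | h | h : A = 1 ∨ A = 3 ∨ A = 6 := by
        have := hA2 rfl
        interval_cases A <;> omega
      · obtain rfl : f = 6 := by rw [h] at hfA; omega
        rw [hd123 h (by omega) rfl, h, ← hAB, h]; decide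
      · obtain rfl : f = 2 := by rw [h] at hfA; omega
        rw [hd33 (by omega) (by omega) (by omega), h, ← hAB, h]; decide
      · obtain rfl : f = 1 := by rw [h] at hfA; omega
        rw [hd6 (by omega) (by omega), h, ← hAB, h]; decide
    · intro g₁ g₂
      obtain rfl := hSa g₁
      obtain rfl := hCb g₂
      have hfB : f * B = 3 := by rw [← hB, ← mul_assoc] at hprod; omega
      have hB3 : B ∣ 3 := ⟨f, by rw [mul_comm, hfB]⟩
      have := hA2 rfl
      rcases (Nat.dvd_prime Nat.prime_three).1 hB3 with h | h
      · omega
      · exact ⟨by rw [h] at hfB; omega, hd6 (by omega) (by omega)⟩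
    · intro g₁ g₂
      obtain rfl := hSa g₁
      obtain rfl := hCb2 g₂
      have hfB : f * B = 2 := by rw [← hB, ← mul_assoc] at hprod; omega
      have hB2 : B ∣ 2 := ⟨f, by rw [mul_comm, hfB]⟩
      rcases (Nat.dvd_prime Nat.prime_two).1 hB2 with h | h
      · obtain rfl : m = 6 := by omega
        rw [hd33 (by omega) (by omega) (by omega)]; decide
      · obtain rfl : m = 12 := by omega
        rw [hd6 (by omega) (by omega)]; decide
    · intro g₁ g₂
      obtain rfl := hSa g₁
      obtain rfl := hCb1 g₂
      have hfB : f * B = 1 := by rw [← hB, ← mul_assoc] at hprod; omega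
      have hB1 := Nat.eq_one_of_mul_eq_one_left hfB
      exact ⟨by omega, hd6 (by omega) (by omega)⟩
    · intro g₁ g₂
      obtain rfl := hCa g₁
      obtain rfl := hCb g₂
      have hfB : f * B = 3 := by rw [← hB, ← mul_assoc] at hprod; omega
      have hB3 : B ∣ 3 := ⟨f, by rw [mul_comm, hfB]⟩
      rcases (Nat.dvd_prime Nat.prime_three).1 hB3 with h | h
      · obtain rfl : A = 1 := by omega
        rw [hd1113 rfl h rfl, h]; decide
      · obtain rfl : A = 3 := by omega
        rw [hd33 (by omega) (by omega) (by omega), h]; decide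
    · intro g₁ g₂
      obtain rfl := hCa g₁
      obtain rfl := hCb2 g₂
      have hfB : f * B = 2 := by rw [← hB, ← mul_assoc] at hprod; omega
      have hB2 : B ∣ 2 := ⟨f, by rw [mul_comm, hfB]⟩
      rcases (Nat.dvd_prime Nat.prime_two).1 hB2 with h | h
      · omega
      · exact ⟨by rw [h] at hfB; omega, hd6 (by omega) (by omega)⟩
    · intro g₁ g₂
      obtain rfl := hCa g₁
      obtain rfl := hCb1 g₂
      have hfB : f * B = 1 := by rw [← hB, ← mul_assoc] at hprod; omega
      have hB1 := Nat.eq_one_of_mul_eq_one_left hfB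
      exact ⟨by omega, hd33 (by omega) (by omega) (by omega)⟩
  · rw [← hfix, heq]
    constructor
    · rintro ⟨hl, hr⟩
      exact exists_fixed K hl hr
    · rintro ⟨φ, hφ⟩
      constructor
      · rw [Subgroup.card_eq_one, Subgroup.eq_bot_iff_forall]
        intro σ hσ
        have := hφ _ hσ
        simpa [eq_comm] using this
      · rw [Subgroup.card_eq_one, Subgroup.eq_bot_iff_forall]
        intro σ hσ
        simpa using hφ _ hσ
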